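/- Graphs are finite and simple. For a graph $G$ and $X\subseteq V(G)$, let $c(G-X)$ be the number of connected components of $G-X$. For a real number $t\ge 0$, $G$ is $t$-tough if $t\cdot c(G-X)\le |X|$ for every $X\subseteq V(G)$ with $c(G-X)>1$. The toughness $\tau(G)$ is the largest $t$ such that $G$ is $t$-tough (with $\tau(G)=\infty$ if $G$ is complete). $G$ is minimally $t$-tough if $\tau(G)=t$ and $\tau(G-e)<t$ for every edge $e$ of $G$. Theorem. For every integer $k\ge 3$ there is a $6$-regular minimally $\frac{2k}{k-1}$-tough graph of order $3k+1$. More precisely, the circulant graph $G=C_{3k+1}(1,2,4)$, whose vertices are the residues modulo $3k+1$ and in which two distinct vertices are adjacent if and only if their difference is $\pm1$, $\pm2$ or $\pm4$ modulo $3k+1$, has order $3k+1$, is $6$-regular, is minimally $\frac{2k}{k-1}$-tough, and has independence number at most $k-1$. Moreover, if $k\ge 5$, then with $t=\frac{2k}{k-1}$ no vertex of $G$ has degree $\lceil 2t\rceil$; that is, $G$ is a counterexample, not $4$-regular, to the generalized Kriesell conjecture that every minimally $t$-tough graph has a vertex of degree $\lceil 2t\rceil$ for every real $t>0$. -/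

import Mathlib

namespace SimpleGraph

/-- The number `c(G - X)` of connected components of the graph obtained from `G` by deleting
the vertices in `X`. -/
noncomputable def numCompDelete {V : Type*} (G : SimpleGraph V) (X : Finset V) : ℕ :=
  Nat.card (G.induce ((X : Set V)ᶜ)).ConnectedComponent

/-- A finite graph `G` is `t`-tough if `t * c(G - X) ≤ |X|` for every set `X` of vertices with
`c(G - X) > 1`. -/
def IsTough {V : Type*} [Finite V] (G : SimpleGraph V) (t : ℝ) : Prop :=
  ∀ X : Finset V, 1 < G.numCompDelete X → t * (G.numCompDelete X : ℝ) ≤ (X.card : ℝ)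

/-- The toughness of a finite graph: the largest `t ≥ 0` such that `G` is `t`-tough, as an
extended real. For a complete graph there is no `X` with `c(G - X) > 1`, so the value is `⊤`;
for every other finite graph the supremum is a maximum, since there are finitely many `X`. -/
noncomputable def toughness {V : Type*} [Finite V] (G : SimpleGraph V) : EReal :=
  sSup {x : EReal | ∃ t : ℝ, 0 ≤ t ∧ G.IsTough t ∧ x = (t : EReal)}

/-- `G` is minimally `t`-tough if its toughness is `t` and deleting any edge gives a graph of
toughness less than `t`. -/
def IsMinimallyTough {V : Type*} [Finite V] (G : SimpleGraph V) (t : ℝ) : Prop :=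
  G.toughness = (t : EReal) ∧ ∀ e ∈ G.edgeSet, (G.deleteEdges {e}).toughness < (t : EReal)

end SimpleGraph

set_option linter.unusedSimpArgs false

/-! Delete X, keep R = Xᶜ, and let c ≥ 2 be the number of components. A component without a right
end could be continued by steps 1 and 2 all around the circle and would absorb R. So each component
has a right end, and each right end is followed by two deleted residues of its own: |X| ≥ 2c.
Difference 4 improves this to |X| ≥ 2c + 2 (`two_mul_card_labels_add_two_le`). Otherwise each
component has exactly one right end and at most one deleted residue is spare. Right ends then follow
one another at distance 3 except next to the spare residue, which is incompatible with 3k ≡ -1.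
Since |R| ≥ c, also c ≤ k - 1; together these give the toughness bound, and singleton labels give
the independence bound. The upper bounds, for G and for G - e, come from keeping roughly every third
residue; rotation leaves one edge to treat for each of the differences 1, 2, 4. -/

namespace CirculantTough

open Finset

/-! ### Counting deleted residues -/

/-- The elements of `R` that are followed by at least two consecutive elements outside `R`. -/
def rightEnds {n : ℕ} (R : Finset (ZMod n)) : Finset (ZMod n) :=
  R.filter fun v => v + 1 ∉ R ∧ v + 2 ∉ R

theorem mem_rightEnds {n : ℕ} {R : Finset (ZMod n)} {v : ZMod n} :
    v ∈ rightEnds R ↔ v ∈ R ∧ v + 1 ∉ R ∧ v + 2 ∉ R := by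
  simp [rightEnds]

/-- If `u` lies in the class of `v + d` and no right end of the class of `v` is met on the way
from `v + d` to `v + n`, then all elements of `R` that are not skipped lie in that class. -/
theorem label_eq_of_walk {n : ℕ} [NeZero n] {α : Type*} {R : Finset (ZMod n)} {f : ZMod n → α}
    (h1 : ∀ x ∈ R, x + 1 ∈ R → f x = f (x + 1)) (h2 : ∀ x ∈ R, x + 2 ∈ R → f x = f (x + 2))
    {v : ZMod n} {c : α} {d : ℕ} (hd : v + d ∈ R) (hfd : f (v + d) = c)
    (hE : ∀ j : ℕ, d ≤ j → j < d + n → v + j ∈ rightEnds R → f (v + j) ≠ c ∨ n ≤ j)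
    (hskip : ∀ j : ℕ, 0 < j → j < d → v + j ∉ R)
    (hv : v ∈ R → f v = c) : ∀ r ∈ R, f r = c := by
  -- The walk with steps 1 and 2 inside class `c` either visits `v + j` or jumps over it, and it
  -- jumps only over residues outside `R`.
  have key : ∀ j : ℕ, d ≤ j → j < n → (v + j ∈ R ∧ f (v + j) = c) ∨
      (v + j ∉ R ∧ v + j + 1 ∈ R ∧ f (v + j + 1) = c) := by
    intro j hj
    induction j, hj using Nat.le_induction with
    | base => exact fun _ => .inl ⟨hd, hfd⟩
    | succ j hj ih =>
      intro hjn
      have e2 : v + (j : ZMod n) + 1 + 1 = v + j + 2 := by ring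
      push_cast
      rw [← add_assoc]
      rcases ih (by omega) with ⟨a, b⟩ | ⟨-, b, b'⟩
      · by_cases m1 : v + j + 1 ∈ R
        · exact .inl ⟨m1, by rw [← h1 _ a m1, b]⟩
        · by_cases m2 : v + j + 2 ∈ R
          · exact .inr ⟨m1, by rw [e2]; exact m2, by rw [e2, ← h2 _ a m2, b]⟩
          · rcases hE j hj (by omega) (mem_rightEnds.2 ⟨a, m1, m2⟩) with h | h
            · exact absurd b h
            · omega
      · exact .inl ⟨b, b'⟩
  intro r hr
  obtain ⟨j, hj, rfl⟩ : ∃ j : ℕ, j < n ∧ r = v + j :=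
    ⟨(r - v).val, ZMod.val_lt _, by simp⟩
  rcases Nat.eq_zero_or_pos j with rfl | hj0
  · simpa using hv (by simpa using hr)
  · rcases lt_or_ge j d with h | h
    · exact absurd hr (hskip j hj0 h)
    · rcases key j h hj with ⟨-, b⟩ | ⟨a, -⟩
      · exact b
      · exact absurd hr a

/-- A set of residues modulo `3k+1` whose elements carry at least two labels, constant along the
differences `1`, `2` and `4`, misses at least `2c+2` residues, where `c` is the number of labels. -/
theorem two_mul_card_labels_add_two_le {k : ℕ} (hk : 2 ≤ k) {α : Type*} [DecidableEq α]
    {R : Finset (ZMod (3 * k + 1))} {f : ZMod (3 * k + 1) → α}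
    (h1 : ∀ x ∈ R, x + 1 ∈ R → f x = f (x + 1)) (h2 : ∀ x ∈ R, x + 2 ∈ R → f x = f (x + 2))
    (h4 : ∀ x ∈ R, x + 4 ∈ R → f x = f (x + 4)) (hc : 2 ≤ (R.image f).card) :
    2 * (R.image f).card + 2 ≤ Rᶜ.card := by
  set E := rightEnds R with hEdef
  have hER : ∀ {v}, v ∈ E → v ∈ R := fun h => (mem_rightEnds.1 h).1
  have hE1 : ∀ {v}, v ∈ E → v + 1 ∉ R := fun h => (mem_rightEnds.1 h).2.1
  have hE2 : ∀ {v}, v ∈ E → v + 2 ∉ R := fun h => (mem_rightEnds.1 h).2.2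
  have nonconst : ∀ c, ¬ ∀ r ∈ R, f r = c := by
    intro c h
    have : R.image f ⊆ {c} := by
      intro x hx
      obtain ⟨r, hr, rfl⟩ := mem_image.1 hx
      simp [h r hr]
    have := card_le_card this
    simp at this
    omega
  have himg : E.image f = R.image f := by
    apply Subset.antisymm (image_subset_image fun _ => hER)
    intro c hcm
    obtain ⟨u, hu, rfl⟩ := mem_image.1 hcm
    by_contra hno
    refine nonconst (f u) (label_eq_of_walk (v := u) (d := 0) h1 h2 (by simpa) (by simp) ?_ ?_
      (fun _ => rfl))
    · intro j _ _ hj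
      exact .inl fun h => hno (mem_image.2 ⟨_, hj, h⟩)
    · intro j _ h
      omega
  have hcE : (R.image f).card ≤ E.card := himg ▸ card_image_le
  set F := E.image (· + 1) ∪ E.image (· + 2) with hF
  have hmemF : ∀ x, x ∈ F ↔ (∃ w ∈ E, w + 1 = x) ∨ ∃ w ∈ E, w + 2 = x := by
    intro x; simp only [hF, mem_union, mem_image]
  have hFcard : F.card = 2 * E.card := by
    rw [hF, card_union_of_disjoint, card_image_of_injective _ (add_left_injective 1),
      card_image_of_injective _ (add_left_injective 2)]
    · ring
    · rw [disjoint_left]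
      intro x hx hx'
      obtain ⟨w, hw, rfl⟩ := mem_image.1 hx
      obtain ⟨u, hu, h⟩ := mem_image.1 hx'
      have : w = u + 1 := by
        have h' : u + 2 = w + 1 := h
        linear_combination -h'
      exact hE1 hu (this ▸ hER hw)
  have hFX : F ⊆ Rᶜ := by
    intro x hx
    rw [mem_compl]
    rcases (hmemF x).1 hx with ⟨w, hw, rfl⟩ | ⟨w, hw, rfl⟩
    exacts [hE1 hw, hE2 hw]
  -- With at most 2c + 1 residues missing, |E| = c: one right end per label, and at most one missing
  -- residue outside `F`.
  by_contra hlt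
  have hle := card_le_card hFX
  have hEc : E.card = (R.image f).card := by omega
  have hinj : ∀ v ∈ E, ∀ w ∈ E, f v = f w → v = w := by
    have : (E.image f).card = E.card := by rw [himg, hEc]
    intro v hv w hw h
    exact (card_image_iff.1 this) hv hw h
  have hZ : ∀ x y, x ∉ R → y ∉ R → x ∉ F → y ∉ F → x = y := by
    intro x y hx hy hxF hyF
    have : (Rᶜ \ F).card ≤ 1 := by
      rw [card_sdiff_of_subset hFX]; omega
    exact card_le_one.1 this x (by simp [hx, hxF]) y (by simp [hy, hyF])
  have natne : ∀ m : ℕ, 0 < m → m < 3 * k + 1 → (m : ZMod (3 * k + 1)) ≠ 0 := by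
    intro m h0 hm h
    rw [ZMod.natCast_eq_zero_iff] at h
    exact absurd (Nat.le_of_dvd h0 h) (by omega)
  have one_ne : (1 : ZMod (3 * k + 1)) ≠ 0 := by
    have := natne 1 (by omega) (by omega)
    simpa using this
  -- If the label of `v` reappears just after the gap, its walk has already passed its only right
  -- end, so it goes all around.
  have hwrap : ∀ v ∈ E, ∀ d : ℕ, 0 < d → d < 3 * k + 1 → v + d ∈ R → f (v + d) = f v →
      ¬ ∀ j : ℕ, 0 < j → j < d → v + j ∉ R := by
    intro v hv d hd0 hd hdR hfd hskip
    refine nonconst (f v) (label_eq_of_walk h1 h2 hdR hfd ?_ hskip (fun _ => rfl))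
    intro j hj _ hjE
    by_contra! hcon
    have := hinj _ hjE _ hv hcon.1
    exact natne j (by omega) hcon.2 (by simpa using this)
  have notF : ∀ x, x - 1 ∉ E → x - 2 ∉ E → x ∉ F := by
    intro x a b h
    rcases (hmemF x).1 h with ⟨w, hw, rfl⟩ | ⟨w, hw, rfl⟩
    · exact a (by simpa using hw)
    · exact b (by simpa using hw)
  -- Otherwise `v + 3` is the spare residue, so `v + 4 ∈ R`, and difference 4 carries the label
  -- across the gap.
  have h3 : ∀ v ∈ E, v + 3 ∈ R := by
    intro v hv
    by_contra h3
    have n3 : v + 3 ∉ F := notF _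
      (fun h => hE2 hv (by convert hER h using 1; ring))
      (fun h => hE1 hv (by convert hER h using 1; ring))
    have m4 : v + 4 ∈ R := by
      by_contra m4
      have n4 : v + 4 ∉ F := notF _
        (fun h => h3 (by convert hER h using 1; ring))
        (fun h => hE2 hv (by convert hER h using 1; ring))
      have := hZ _ _ h3 m4 n3 n4
      exact one_ne (by linear_combination -this)
    refine hwrap v hv 4 (by omega) (by omega) (by simpa using m4)
      (by simpa using (h4 v (hER hv) m4).symm) ?_
    intro j hj0 hj
    interval_cases j
    · simpa using hE1 hv
    · simpa using hE2 hv
    · simpa using h3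
  have h3ne : ∀ v ∈ E, f (v + 3) ≠ f v := by
    intro v hv h
    refine hwrap v hv 3 (by omega) (by omega) (by simpa using h3 v hv) (by simpa using h) ?_
    intro j hj0 hj
    interval_cases j
    · simpa using hE1 hv
    · simpa using hE2 hv
  -- `v - 1` would link `v` (difference 1) to `v + 3` (difference 4).
  have hm1 : ∀ v ∈ E, v - 1 ∉ R := by
    intro v hv h
    have a := h1 _ h (by simpa using hER hv)
    have e : v - 1 + 4 = v + 3 := by ring
    have b := h4 _ h (by rw [e]; exact h3 v hv)
    rw [e] at b
    simp only [sub_add_cancel] at a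
    exact h3ne v hv (b.symm.trans a)
  have hp4 : ∀ v ∈ E, v + 4 ∉ R := by
    intro v hv h
    have e : v + 3 + 1 = v + 4 := by ring
    have a := h1 _ (h3 v hv) (by rwa [e])
    rw [e] at a
    exact h3ne v hv (a.trans (h4 _ (hER hv) h).symm)
  have back : ∀ v ∈ E, v - 3 ∈ E ∨ v - 1 ∉ F := by
    intro v hv
    by_contra! h
    rcases (hmemF _).1 h.2 with ⟨w, hw, e⟩ | ⟨w, hw, e⟩
    · exact hE2 hw (by convert hER hv using 1; linear_combination e)
    · exact h.1 (by convert hw using 1; linear_combination -e)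
  have fwd : ∀ v ∈ E, v + 3 ∈ E ∨ v + 4 ∉ F := by
    intro v hv
    by_contra! h
    rcases (hmemF _).1 h.2 with ⟨w, hw, e⟩ | ⟨w, hw, e⟩
    · exact h.1 (by convert hw using 1; linear_combination -e)
    · exact hE2 hv (by convert hER hw using 1; linear_combination -e)
  have h3k : (3 * (k : ZMod (3 * k + 1))) = -1 := by
    have := ZMod.natCast_self (3 * k + 1)
    push_cast at this
    linear_combination this
  obtain ⟨v₀, hv₀⟩ : E.Nonempty := card_pos.1 (by omega)
  -- Otherwise `E` is closed under subtracting 3 and contains v₀ - 3k = v₀ + 1.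
  obtain ⟨v, hv, hvF⟩ : ∃ v ∈ E, v - 1 ∉ F := by
    by_contra! hall
    have : ∀ j : ℕ, v₀ - 3 * j ∈ E := by
      intro j
      induction j with
      | zero => simpa using hv₀
      | succ j ih =>
        convert (back _ ih).resolve_right (not_not.2 (hall _ ih)) using 1
        push_cast; ring
    have := this k
    rw [h3k] at this
    exact hE1 hv₀ (by simpa using hER this)
  -- The spare residue is `v - 1`. Stepping forward by 3 cannot meet it as v + 3j + 4 with j < k,
  -- because 3j + 5 is not a multiple of 3k + 1; so `E` reaches v + 3k = v - 1.
  have : ∀ j : ℕ, j ≤ k → v + 3 * j ∈ E := by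
    intro j
    induction j with
    | zero => simpa using hv
    | succ j ih =>
      intro hj
      have ih := ih (by omega)
      rcases fwd _ ih with h | h
      · convert h using 1
        push_cast; ring
      · exfalso
        have := hZ _ _ (hm1 v hv) (hp4 _ ih) hvF h
        have h0 : ((3 * j + 5 : ℕ) : ZMod (3 * k + 1)) = 0 := by
          push_cast
          linear_combination -this
        rw [ZMod.natCast_eq_zero_iff] at h0
        obtain ⟨q, hq⟩ := h0
        have : q < 2 := by
          by_contra! hq2
          have := Nat.mul_le_mul_left (3 * k + 1) hq2
          omega
        interval_cases q <;> omega
  have := this k le_rfl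
  rw [h3k] at this
  exact hm1 v hv (by simpa [sub_eq_add_neg] using hER this)

/-! ### Components and labellings -/

section Toughness

open SimpleGraph

variable {V : Type*} [Fintype V] [DecidableEq V]

theorem exists_componentLabel (G : SimpleGraph V) (X : Finset V) :
    ∃ f : V → Option (G.induce ((X : Set V)ᶜ)).ConnectedComponent,
      (∀ x ∈ Xᶜ, ∀ y ∈ Xᶜ, G.Adj x y → f x = f y) ∧
      Set.ncard (f '' (Xᶜ : Finset V)) = G.numCompDelete X := by
  classical
  -- Deleted vertices get the dummy label `none`, which never occurs on `Xᶜ`.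
  refine ⟨fun x => if h : x ∈ ((X : Set V)ᶜ) then
    some ((G.induce ((X : Set V)ᶜ)).connectedComponentMk ⟨x, h⟩) else none, ?_, ?_⟩
  · intro x hx y hy hxy
    have hx' : x ∈ ((X : Set V)ᶜ) := by simpa using hx
    have hy' : y ∈ ((X : Set V)ᶜ) := by simpa using hy
    simp only [dif_pos hx', dif_pos hy']
    congr 1
    apply ConnectedComponent.sound
    exact Adj.reachable (by simpa using hxy)
  · rw [numCompDelete, ← Set.ncard_univ,
      ← Set.ncard_image_of_injective Set.univ (Option.some_injective _)]
    congr 1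
    refine Set.ext fun c => ?_
    constructor
    · rintro ⟨x, hx, rfl⟩
      have hx' : x ∈ ((X : Set V)ᶜ) := by simpa using hx
      simp only [dif_pos hx']
      exact ⟨_, trivial, rfl⟩
    · rintro ⟨c, -, rfl⟩
      induction c using ConnectedComponent.ind with
      | h v => exact ⟨v.1, by simp, by simp only [dif_pos v.2]⟩

/-- A labelling constant along edges factors through the components, so exhibiting one bounds their
number from below. -/
theorem card_le_numCompDelete (G : SimpleGraph V) (W : Finset V) (g : V → ℕ)
    (h : ∀ x ∈ W, ∀ y ∈ W, G.Adj x y → g x = g y) : (W.image g).card ≤ G.numCompDelete Wᶜ := by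
  classical
  have hmem : ∀ v : ((Wᶜ : Finset V) : Set V)ᶜ.Elem, v.1 ∈ W := fun v => by simpa using v.2
  let F : (G.induce (((Wᶜ : Finset V) : Set V)ᶜ)).ConnectedComponent → W.image g :=
    ConnectedComponent.lift (fun v => ⟨g v.1, mem_image_of_mem g (hmem v)⟩) (by
      intro v w p _
      induction p with
      | nil => rfl
      | cons hadj p ih =>
        refine Eq.trans ?_ (ih (by simp_all))
        exact Subtype.ext (h _ (hmem _) _ (hmem _) (by simpa using hadj)))
  have hF : Function.Surjective F := by
    rintro ⟨c, hc⟩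
    obtain ⟨x, hx, rfl⟩ := mem_image.1 hc
    exact ⟨connectedComponentMk _ ⟨x, by simpa using hx⟩, rfl⟩
  have := Nat.card_le_card_of_surjective F hF
  rwa [Nat.card_eq_fintype_card, Fintype.card_coe] at this

omit [DecidableEq V] in
theorem toughness_le_of_le_numCompDelete {G : SimpleGraph V} {X : Finset V} {c : ℕ} (hc : 1 < c)
    (h : c ≤ G.numCompDelete X) : G.toughness ≤ (((X.card : ℝ) / c : ℝ) : EReal) := by
  refine sSup_le ?_
  rintro _ ⟨t, ht0, ht, rfl⟩
  rw [EReal.coe_le_coe_iff, le_div_iff₀ (by positivity)]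
  exact (mul_le_mul_of_nonneg_left (by exact_mod_cast h) ht0).trans (ht X (by omega))

end Toughness

/-- The arithmetic progression `b, b + 3, …, b + 3 (m - 1)`. -/
def arithProg (m b : ℕ) : Finset ℕ := (range m).image (3 * · + b)

theorem mem_arithProg {m b i : ℕ} :
    i ∈ arithProg m b ↔ b ≤ i ∧ i < 3 * m + b ∧ (i - b) % 3 = 0 := by
  simp only [arithProg, mem_image, mem_range]
  constructor
  · rintro ⟨u, hu, rfl⟩
    omega
  · intro h
    exact ⟨(i - b) / 3, by omega, by omega⟩

theorem card_arithProg (m b : ℕ) : (arithProg m b).card = m := by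
  rw [arithProg, card_image_of_injective _ fun x y (h : 3 * x + b = 3 * y + b) => by omega,
    card_range]

theorem natCast_add_eq_natCast {n i j s : ℕ} (hi : i < n) (hj : j < n) (hs : s < n)
    (h : (i : ZMod n) - j = s) : i = j + s ∨ i + n = j + s := by
  have h' : ((i : ℕ) : ZMod n) = ((j + s : ℕ) : ZMod n) := by
    push_cast; linear_combination h
  rw [ZMod.natCast_eq_natCast_iff'] at h'
  rw [Nat.mod_eq_of_lt hi] at h'
  rcases lt_or_ge (j + s) n with hlt | hge
  · rw [Nat.mod_eq_of_lt hlt] at h'; exact .inl h'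
  · rw [Nat.mod_eq_sub_mod hge, Nat.mod_eq_of_lt (by omega)] at h'; omega

/-- An upper bound for the toughness of a graph on the residues modulo `n`, obtained by keeping
only the residues `a + i`, `i ∈ N`, when their adjacencies preserve a labelling `g` of `N`. -/
theorem toughness_le_of_labels {n : ℕ} [NeZero n] (H : SimpleGraph (ZMod n)) (a : ZMod n)
    (N : Finset ℕ) (g : ℕ → ℕ) {c m : ℕ} (hN : ∀ i ∈ N, i < n) (hcard : n ≤ m + N.card)
    (hc : 1 < c) (hg : ∀ j < c, ∃ i ∈ N, g i = j)
    (hadj : ∀ i ∈ N, ∀ j ∈ N, H.Adj (a + i) (a + j) → g i = g j) :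
    H.toughness ≤ (((m : ℝ) / c : ℝ) : EReal) := by
  have hval : ∀ i ∈ N, (a + (i : ZMod n) - a).val = i := by
    intro i hi
    rw [add_sub_cancel_left, ZMod.val_cast_of_lt (hN i hi)]
  set W : Finset (ZMod n) := N.image fun i : ℕ => a + (i : ZMod n) with hW
  have hWN : W.card = N.card := by
    refine card_image_of_injOn fun i hi j hj h => ?_
    have h' : a + (i : ZMod n) = a + (j : ZMod n) := h
    rw [← hval i hi, h', hval j hj]
  have h1 : c ≤ (W.image fun x => g (x - a).val).card := by
    rw [← card_range c]
    refine card_le_card fun j hj => ?_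
    obtain ⟨i, hi, rfl⟩ := hg j (mem_range.1 hj)
    exact mem_image.2 ⟨a + i, mem_image_of_mem _ hi, by rw [hval i hi]⟩
  have h2 := card_le_numCompDelete H W (fun x => g (x - a).val) (by
    intro x hx y hy hxy
    obtain ⟨i, hi, rfl⟩ := mem_image.1 hx
    obtain ⟨j, hj, rfl⟩ := mem_image.1 hy
    simpa only [hval i hi, hval j hj] using hadj i hi j hj hxy)
  refine (toughness_le_of_le_numCompDelete hc (h1.trans h2)).trans ?_
  rw [EReal.coe_le_coe_iff]
  have : Wᶜ.card ≤ m := by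
    rw [card_compl, ZMod.card]; omega
  gcongr

/-! ### Toughness and independence number of the circulant graph -/

variable {k : ℕ}

local notation "C" => SimpleGraph.circulantGraph ({1, 2, 4} : Set (ZMod (3 * k + 1)))

theorem adj_iff_exists {x y : ZMod (3 * k + 1)} (hk : 3 ≤ k) :
    (C).Adj x y ↔ ∃ s : ℕ, (s = 1 ∨ s = 2 ∨ s = 4) ∧ (x - y = s ∨ y - x = s) := by
  have hs : ∀ s : ℕ, (s = 1 ∨ s = 2 ∨ s = 4) → (s : ZMod (3 * k + 1)) ≠ 0 := by
    intro s hs h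
    rw [ZMod.natCast_eq_zero_iff] at h
    have := Nat.le_of_dvd (by omega) h
    omega
  simp only [SimpleGraph.circulantGraph_adj, Set.mem_insert_iff, Set.mem_singleton_iff]
  constructor
  · rintro ⟨-, (h | h | h) | (h | h | h)⟩
    exacts [⟨1, by simp, .inl (by simpa)⟩, ⟨2, by simp, .inl (by simpa)⟩,
      ⟨4, by simp, .inl (by simpa)⟩, ⟨1, by simp, .inr (by simpa)⟩, ⟨2, by simp, .inr (by simpa)⟩,
      ⟨4, by simp, .inr (by simpa)⟩]
  · rintro ⟨s, h, h'⟩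
    refine ⟨?_, ?_⟩
    · rintro rfl
      rw [sub_self] at h'
      exact hs s h (by simpa [eq_comm] using h')
    · rcases h with rfl | rfl | rfl <;> rcases h' with h' | h' <;> simp [h']

/-- Turns adjacency modulo 3k + 1 into linear conditions on naturals, for `omega`. -/
theorem adj_shift {a : ZMod (3 * k + 1)} {i j : ℕ} (hk : 3 ≤ k) (hi : i < 3 * k + 1)
    (hj : j < 3 * k + 1) (h : (C).Adj (a + i) (a + j)) :
    ∃ s : ℕ, (s = 1 ∨ s = 2 ∨ s = 4) ∧
      (i = j + s ∨ i + (3 * k + 1) = j + s ∨ j = i + s ∨ j + (3 * k + 1) = i + s) := by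
  obtain ⟨s, hs, h⟩ := (adj_iff_exists hk).1 h
  rw [add_sub_add_left_eq_sub, add_sub_add_left_eq_sub] at h
  refine ⟨s, hs, ?_⟩
  rcases h with h | h
  · have := natCast_add_eq_natCast hi hj (by omega) h; omega
  · have := natCast_add_eq_natCast hj hi (by omega) h; omega

theorem isTough_circulant (hk : 3 ≤ k) : (C).IsTough (2 * (k : ℝ) / ((k : ℝ) - 1)) := by
  classical
  intro X hX
  obtain ⟨f, hf, hcard⟩ := exists_componentLabel (C) X
  rw [← coe_image, Set.ncard_coe_finset] at hcard
  have adj : ∀ s : ℕ, (s = 1 ∨ s = 2 ∨ s = 4) → ∀ x ∈ Xᶜ, x + s ∈ Xᶜ → f x = f (x + s) :=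
    fun s hs x hx hy => hf x hx _ hy ((adj_iff_exists hk).2 ⟨s, hs, .inr (by ring)⟩)
  have key := two_mul_card_labels_add_two_le (by omega) (R := Xᶜ) (f := f)
    (by simpa using adj 1 (by simp)) (by simpa using adj 2 (by simp))
    (by simpa using adj 4 (by simp)) (by omega)
  have hle : (Xᶜ.image f).card ≤ Xᶜ.card := card_image_le
  have htot := card_add_card_compl X
  rw [ZMod.card] at htot
  rw [compl_compl, hcard] at key
  rw [hcard] at hle
  set c := (C).numCompDelete X
  have hck : c + 1 ≤ k := by omega
  have hck' : (c : ℝ) + 1 ≤ k := by exact_mod_cast hck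
  have key' : 2 * (c : ℝ) + 2 ≤ X.card := by exact_mod_cast key
  have hk' : (3 : ℝ) ≤ k := by exact_mod_cast hk
  rw [div_mul_eq_mul_div, div_le_iff₀ (by linarith)]
  nlinarith

theorem indepNum_circulant_le (hk : 3 ≤ k) : (C).indepNum ≤ k - 1 := by
  classical
  obtain ⟨S, hS⟩ := (C).exists_isNIndepSet_indepNum
  rw [← hS.card_eq]
  by_contra! hlt
  have adj : ∀ s : ℕ, (s = 1 ∨ s = 2 ∨ s = 4) → ∀ x ∈ S, x + s ∈ S → x = x + s := by
    intro s hs x hx hy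
    by_contra hne
    exact hS.isIndepSet hx hy hne ((adj_iff_exists hk).2 ⟨s, hs, .inr (by ring)⟩)
  have key := two_mul_card_labels_add_two_le (by omega) (R := S) (f := id)
    (by simpa using adj 1 (by simp)) (by simpa using adj 2 (by simp))
    (by simpa using adj 4 (by simp)) (by rw [image_id]; omega)
  rw [image_id, card_compl, ZMod.card] at key
  omega

theorem toughness_circulant (hk : 3 ≤ k) :
    (C).toughness = ((2 * (k : ℝ) / ((k : ℝ) - 1) : ℝ) : EReal) := by
  have hk' : (3 : ℝ) ≤ k := by exact_mod_cast hk
  apply le_antisymm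
  -- One component {0, 2, 4}, and singletons 7, 10, …, 3k - 2.
  · have := toughness_le_of_labels (C) 0 (insert 0 (insert 2 (arithProg (k - 1) 4)))
      (fun i => if i = 0 ∨ i = 2 then 0 else (i - 4) / 3) (c := k - 1) (m := 2 * k)
      (by simp only [mem_insert, mem_arithProg]; omega) (by
        rw [card_insert_of_notMem (by simp only [mem_insert, mem_arithProg]; omega),
        card_insert_of_notMem (by simp only [mem_insert, mem_arithProg]; omega),
          card_arithProg]
        omega) (by omega)
      (fun j hj => ⟨3 * j + 4, by simp only [mem_insert, mem_arithProg]; omega,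
          by split_ifs <;> first | omega | simp_all⟩)
      (by
        intro i hi j hj h
        simp only [mem_insert, mem_arithProg] at hi hj
        obtain ⟨s, hs, h⟩ := adj_shift hk (by omega) (by omega) h
        split_ifs <;> omega)
    refine this.trans_eq ?_
    rw [Nat.cast_sub (by omega)]
    push_cast
    rfl
  · exact le_sSup ⟨_, div_nonneg (by linarith) (by linarith), isTough_circulant hk, rfl⟩

/-! ### Deleting an edge -/

theorem not_adj_deleteEdges {V : Type*} {G : SimpleGraph V} {a b x y : V}
    (h : (G.deleteEdges {s(a, b)}).Adj x y) : ¬ (x = a ∧ y = b) ∧ ¬ (x = b ∧ y = a) := by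
  simpa [not_or] using (SimpleGraph.deleteEdges_adj.1 h).2

theorem adj_shift_deleteEdges {a : ZMod (3 * k + 1)} {d i j : ℕ} (hk : 3 ≤ k)
    (hi : i < 3 * k + 1) (hj : j < 3 * k + 1)
    (h : ((C).deleteEdges {s(a, a + d)}).Adj (a + i) (a + j)) :
    ¬ (i = 0 ∧ j = d) ∧ ¬ (i = d ∧ j = 0) ∧ ∃ s : ℕ, (s = 1 ∨ s = 2 ∨ s = 4) ∧
      (i = j + s ∨ i + (3 * k + 1) = j + s ∨ j = i + s ∨ j + (3 * k + 1) = i + s) := by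
  obtain ⟨h1, h2⟩ := not_adj_deleteEdges h
  refine ⟨?_, ?_, adj_shift hk hi hj (SimpleGraph.deleteEdges_adj.1 h).1⟩
  · rintro ⟨rfl, rfl⟩; simp at h1
  · rintro ⟨rfl, rfl⟩; simp at h2

theorem toughness_deleteEdges_one_lt (hk : 3 ≤ k) (a : ZMod (3 * k + 1)) :
    ((C).deleteEdges {s(a, a + (1 : ℕ))}).toughness <
      ((2 * (k : ℝ) / ((k : ℝ) - 1) : ℝ) : EReal) := by
  have hk' : (3 : ℝ) ≤ k := by exact_mod_cast hk
  -- Components {3k - 3, 3k - 1, 0} and {1, 3}, separated only by the loss of edge 01; the rest are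
  -- singletons.
  have := toughness_le_of_labels ((C).deleteEdges {s(a, a + (1 : ℕ))}) a
    (insert 1 (insert (3 * k - 1) (arithProg k 0)))
    (fun i => if i = 3 * k - 1 ∨ i = 3 * k - 3 then 0 else if i = 1 then 1 else i / 3)
    (c := k - 1) (m := 2 * k - 1)
    (by simp only [mem_insert, mem_arithProg]; omega) (by
      rw [card_insert_of_notMem (by simp only [mem_insert, mem_arithProg]; omega),
        card_insert_of_notMem (by simp only [mem_insert, mem_arithProg]; omega),
        card_arithProg]
      omega) (by omega)
    (fun j hj => ⟨3 * j, by simp only [mem_insert, mem_arithProg]; omega, by split_ifs <;> omega⟩)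
    (by
      intro i hi j hj h
      simp only [mem_insert, mem_arithProg] at hi hj
      obtain ⟨h0, h1, s, hs, h⟩ := adj_shift_deleteEdges hk (by omega) (by omega) h
      split_ifs <;> omega)
  refine this.trans_lt ?_
  rw [EReal.coe_lt_coe_iff, Nat.cast_sub (by omega), Nat.cast_sub (by omega)]
  push_cast
  exact div_lt_div_of_pos_right (by linarith) (by linarith)

theorem toughness_deleteEdges_two_lt (hk : 3 ≤ k) (a : ZMod (3 * k + 1)) :
    ((C).deleteEdges {s(a, a + (2 : ℕ))}).toughness <
      ((2 * (k : ℝ) / ((k : ℝ) - 1) : ℝ) : EReal) := by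
  have hk' : (3 : ℝ) ≤ k := by exact_mod_cast hk
  -- 0 and 2 become separate singletons; {5, 7} is the only larger component. The ratio is 2.
  have := toughness_le_of_labels ((C).deleteEdges {s(a, a + (2 : ℕ))}) a
    (insert 0 (insert 2 (insert 5 (arithProg (k - 2) 7))))
    (fun i => if i = 0 then 0 else if i = 2 then 1 else if i = 5 then 2 else (i - 1) / 3)
    (c := k) (m := 2 * k)
    (by simp only [mem_insert, mem_arithProg]; omega) (by
      rw [card_insert_of_notMem (by simp only [mem_insert, mem_arithProg]; omega),
        card_insert_of_notMem (by simp only [mem_insert, mem_arithProg]; omega),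
        card_insert_of_notMem (by simp only [mem_insert, mem_arithProg]; omega),
        card_arithProg]
      omega) (by omega)
    (by
      intro j hj
      rcases lt_or_ge j 2 with h | h
      · exact ⟨2 * j, by simp only [mem_insert, mem_arithProg]; omega, by split_ifs <;> omega⟩
      · exact ⟨3 * (j - 2) + 7, by simp only [mem_insert, mem_arithProg]; omega,
          by split_ifs <;> first | omega | simp_all⟩)
    (by
      intro i hi j hj h
      simp only [mem_insert, mem_arithProg] at hi hj
      obtain ⟨h0, h1, s, hs, h⟩ := adj_shift_deleteEdges hk (by omega) (by omega) h
      split_ifs <;> omega)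
  refine this.trans_lt ?_
  rw [EReal.coe_lt_coe_iff]
  push_cast
  exact div_lt_div_of_pos_left (by linarith) (by linarith) (by linarith)

theorem toughness_deleteEdges_four_lt (hk : 3 ≤ k) (a : ZMod (3 * k + 1)) :
    ((C).deleteEdges {s(a, a + (4 : ℕ))}).toughness <
      ((2 * (k : ℝ) / ((k : ℝ) - 1) : ℝ) : EReal) := by
  have hk' : (3 : ℝ) ≤ k := by exact_mod_cast hk
  -- Without edge 04 the set 0, 4, 7, …, 3k - 2 is independent.
  have := toughness_le_of_labels ((C).deleteEdges {s(a, a + (4 : ℕ))}) a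
    (insert 0 (arithProg (k - 1) 4))
    (fun i => if i = 0 then k - 1 else (i - 4) / 3)
    (c := k) (m := 2 * k + 1)
    (by simp only [mem_insert, mem_arithProg]; omega) (by
      rw [card_insert_of_notMem (by simp only [mem_insert, mem_arithProg]; omega),
        card_arithProg]
      omega) (by omega)
    (by
      intro j hj
      rcases lt_or_ge j (k - 1) with h | h
      · exact ⟨3 * j + 4, by simp only [mem_insert, mem_arithProg]; omega,
          by split_ifs <;> first | omega | simp_all⟩
      · exact ⟨0, mem_insert_self _ _, by split_ifs <;> omega⟩)
    (by
      intro i hi j hj h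
      simp only [mem_insert, mem_arithProg] at hi hj
      obtain ⟨h0, h1, s, hs, h⟩ := adj_shift_deleteEdges hk (by omega) (by omega) h
      split_ifs <;> omega)
  refine this.trans_lt ?_
  rw [EReal.coe_lt_coe_iff]
  push_cast
  rw [div_lt_div_iff₀ (by linarith) (by linarith)]
  nlinarith

theorem isMinimallyTough_circulant (hk : 3 ≤ k) :
    (C).IsMinimallyTough (2 * (k : ℝ) / ((k : ℝ) - 1)) := by
  refine ⟨toughness_circulant hk, fun e he => ?_⟩
  have main : ∀ (s : ℕ) (x y : ZMod (3 * k + 1)), (s = 1 ∨ s = 2 ∨ s = 4) → y - x = s →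
      ((C).deleteEdges {s(x, y)}).toughness < ((2 * (k : ℝ) / ((k : ℝ) - 1) : ℝ) : EReal) := by
    intro s x y hs h
    obtain rfl : y = x + s := by linear_combination h
    rcases hs with rfl | rfl | rfl
    exacts [toughness_deleteEdges_one_lt hk x, toughness_deleteEdges_two_lt hk x,
      toughness_deleteEdges_four_lt hk x]
  induction e using Sym2.ind with
  | h x y =>
    obtain ⟨s, hs, h | h⟩ := (adj_iff_exists hk).1 (SimpleGraph.mem_edgeSet _ |>.1 he)
    · rw [Sym2.eq_swap]
      exact main s y x hs h
    · exact main s x y hs h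

/-! ### Degrees -/

theorem isRegularOfDegree_circulant (hk : 3 ≤ k) [DecidableRel (C).Adj] :
    (C).IsRegularOfDegree 6 := by
  intro v
  have hset : (C).neighborFinset v =
      ({1, 2, 4, 3 * k, 3 * k - 1, 3 * k - 3} : Finset ℕ).image
        (fun i : ℕ => v + (i : ZMod (3 * k + 1))) := by
    have h0 := ZMod.natCast_self (3 * k + 1)
    have e1 : ((3 * k - 1 : ℕ) : ZMod (3 * k + 1)) = -2 := by
      rw [Nat.cast_sub (by omega)]; push_cast at h0 ⊢; linear_combination h0
    have e3 : ((3 * k - 3 : ℕ) : ZMod (3 * k + 1)) = -4 := by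
      rw [Nat.cast_sub (by omega)]; push_cast at h0 ⊢; linear_combination h0
    have e0 : ((3 * k : ℕ) : ZMod (3 * k + 1)) = -1 := by
      push_cast at h0 ⊢; linear_combination h0
    ext w
    rw [SimpleGraph.mem_neighborFinset, adj_iff_exists hk]
    simp only [image_insert, image_singleton, mem_insert, mem_singleton, e0, e1, e3]
    constructor
    · rintro ⟨s, rfl | rfl | rfl, h | h⟩ <;> push_cast at h ⊢
      · exact .inr <| .inr <| .inr <| .inl (by linear_combination -h)
      · exact .inl (by linear_combination h)
      · exact .inr <| .inr <| .inr <| .inr <| .inl (by linear_combination -h)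
      · exact .inr <| .inl (by linear_combination h)
      · exact .inr <| .inr <| .inr <| .inr <| .inr (by linear_combination -h)
      · exact .inr <| .inr <| .inl (by linear_combination h)
    · rintro (rfl | rfl | rfl | rfl | rfl | rfl)
      · exact ⟨1, by simp, .inr (by simp)⟩
      · exact ⟨2, by simp, .inr (by simp)⟩
      · exact ⟨4, by simp, .inr (by simp)⟩
      · exact ⟨1, by simp, .inl (by simp)⟩
      · exact ⟨2, by simp, .inl (by simp)⟩
      · exact ⟨4, by simp, .inl (by simp)⟩
  rw [← SimpleGraph.card_neighborFinset_eq_degree, hset, card_image_of_injOn]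
  · repeat rw [card_insert_of_notMem (by simp; omega)]
    simp
  · intro i hi j hj h
    have hlt : ∀ i ∈ ({1, 2, 4, 3 * k, 3 * k - 1, 3 * k - 3} : Finset ℕ), i < 3 * k + 1 := by
      simp; omega
    have h' : (i : ZMod (3 * k + 1)) = j := add_left_cancel h
    rw [← ZMod.val_cast_of_lt (hlt i hi), h', ZMod.val_cast_of_lt (hlt j hj)]

/-- 2t = 4 + 4/(k - 1) lies in (4, 5] exactly from k = 5 on. -/
theorem ceil_two_mul_toughness (hk : 5 ≤ k) :
    ⌈2 * (2 * (k : ℝ) / ((k : ℝ) - 1))⌉ = 5 := by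
  have hk' : (5 : ℝ) ≤ k := by exact_mod_cast hk
  rw [Int.ceil_eq_iff, ← mul_div_assoc, lt_div_iff₀ (by linarith), div_le_iff₀ (by linarith)]
  push_cast
  constructor <;> linarith

end CirculantTough

theorem theorem2 (k : ℕ) (hk : 3 ≤ k) :
    ∃ (G : SimpleGraph (ZMod (3 * k + 1))) (_ : DecidableRel G.Adj),
      G = SimpleGraph.circulantGraph ({1, 2, 4} : Set (ZMod (3 * k + 1))) ∧
      Fintype.card (ZMod (3 * k + 1)) = 3 * k + 1 ∧
      G.IsRegularOfDegree 6 ∧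
      G.IsMinimallyTough (2 * (k : ℝ) / ((k : ℝ) - 1)) ∧
      G.indepNum ≤ k - 1 ∧
      (5 ≤ k → ∀ v, (G.degree v : ℤ) ≠ ⌈2 * (2 * (k : ℝ) / ((k : ℝ) - 1))⌉) := by
  classical
  have hreg := CirculantTough.isRegularOfDegree_circulant hk
  refine ⟨_, inferInstance, rfl, ZMod.card _, hreg, CirculantTough.isMinimallyTough_circulant hk,
    CirculantTough.indepNum_circulant_le hk, fun h v => ?_⟩
  rw [CirculantTough.ceil_two_mul_toughness h, hreg v]
  norm_num
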